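/- Let $R$ be a linearly ordered field, let $n \ge 0$, and write $\langle c, x\rangle = \sum_{i=1}^n c_i x_i$ for $c, x \in R^n$. Let $P \subseteq R^n$ be a polytope, i.e. a bounded set of the form $P = \{x \in R^n : Ax \ge b\}$ with $A \in R^{m\times n}$, $b \in R^m$. A face of $P$ is a set that is either empty or equal to the set of points of $P$ minimizing $x \mapsto \langle c, x\rangle$ over $P$, for some $c \in R^n$. A vertex of $P$ is a point $x$ such that $\{x\}$ is a face of $P$, and two points $v \ne w$ are adjacent in $P$ if the segment $[v,w]$ is a face of $P$ (that is, an edge, or 1-dimensional face). Then the graph of $P$ is connected: for any two vertices $v$ and $w$ of $P$ there is a finite sequence $v = w_0, w_1, \dots, w_q = w$ ($q \ge 0$) of vertices of $P$ such that $w_{k}$ and $w_{k+1}$ are adjacent in $P$ for every $0 \le k < q$. -/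

import Mathlib

namespace Polyhedra

/-- A (convex) polyhedron of `R^n`: the solution set of a finite system of
linear affine inequalities `A x ≥ b`. -/
def IsPolyhedron {R : Type*} [Field R] [LinearOrder R] {n : ℕ}
    (P : Set (Fin n → R)) : Prop :=
  ∃ (m : ℕ) (A : Matrix (Fin m) (Fin n) R) (b : Fin m → R),
    P = {x | ∀ i, b i ≤ A.mulVec x i}

/-- A set is bounded when all coordinates of its points are uniformly bounded in absolute value. -/
def IsBoundedSet {R : Type*} [Field R] [LinearOrder R] {n : ℕ}
    (P : Set (Fin n → R)) : Prop :=
  ∃ M : R, ∀ x ∈ P, ∀ i, |x i| ≤ M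

/-- A polytope: a bounded polyhedron. -/
def IsPolytope {R : Type*} [Field R] [LinearOrder R] {n : ℕ}
    (P : Set (Fin n → R)) : Prop :=
  IsPolyhedron P ∧ IsBoundedSet P

/-- The set of points of `P` minimizing the linear function `x ↦ ⟨c, x⟩` over `P`. -/
def argmin {R : Type*} [Field R] [LinearOrder R] {n : ℕ}
    (P : Set (Fin n → R)) (c : Fin n → R) : Set (Fin n → R) :=
  {x | x ∈ P ∧ ∀ y ∈ P, dotProduct c x ≤ dotProduct c y}

/-- `F` is a face of `P`: it is empty, or it is the set of minimizers over `P` of a linear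
function. -/
def IsFace {R : Type*} [Field R] [LinearOrder R] {n : ℕ}
    (P F : Set (Fin n → R)) : Prop :=
  F = ∅ ∨ ∃ c : Fin n → R, F = argmin P c

/-- The vertices of `P`: the points `x` such that `{x}` is a face of `P`. -/
def vertexSet {R : Type*} [Field R] [LinearOrder R] {n : ℕ}
    (P : Set (Fin n → R)) : Set (Fin n → R) :=
  {x | IsFace P {x}}

/-- `v` and `w` are adjacent in `P`: they are distinct and the segment joining them is a face
(hence an edge, i.e. a 1-dimensional face) of `P`. -/
def Adj {R : Type*} [Field R] [LinearOrder R] {n : ℕ}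
    (P : Set (Fin n → R)) (v w : Fin n → R) : Prop :=
  v ≠ w ∧ IsFace P (segment R v w)

end Polyhedra

namespace Polyhedra

/-! This is the simplex method. Take `c` minimized over the polytope only at `w`. Every vertex other
than `w` has a neighbour with smaller `c`-value (`exists_adj_lt`), and there are finitely many
vertices, so a `c`-lowest vertex not joined to `w` cannot exist. The neighbour lies along an extreme
ray of the cone of feasible directions, chosen so that `c` decreases
(`exists_decreasing_extreme_direction`). Boundedness makes some constraint block this ray, and the
blocking point is the new vertex. -/

/-- Ratio test: moving from a nonnegative family `f` in a direction `g` with a negative entry, stop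
when the first entry vanishes. -/
theorem exists_ratio_test {R ι : Type*} [Field R] [LinearOrder R] [IsStrictOrderedRing R]
    (S : Finset ι) (f g : ι → R) (hf : ∀ i ∈ S, 0 ≤ f i) (hg : ∃ i ∈ S, g i < 0) :
    ∃ t : R, 0 ≤ t ∧ (∀ i ∈ S, 0 ≤ f i + t * g i) ∧ ∃ j ∈ S, g j < 0 ∧ f j + t * g j = 0 := by
  classical
  obtain ⟨i₀, hi₀, hgi₀⟩ := hg
  obtain ⟨j, hj, hmin⟩ := (S.filter fun i => g i < 0).exists_min_image (fun i => f i / (-g i))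
    ⟨i₀, Finset.mem_filter.2 ⟨hi₀, hgi₀⟩⟩
  obtain ⟨hjS, hgj⟩ := Finset.mem_filter.1 hj
  have ht : 0 ≤ f j / (-g j) := div_nonneg (hf j hjS) (by linarith)
  refine ⟨f j / (-g j), ht, fun i hi => ?_, j, hjS, hgj, ?_⟩
  · rcases lt_or_ge (g i) 0 with h | h
    · have h₁ := hmin i (Finset.mem_filter.2 ⟨hi, h⟩)
      rw [le_div_iff₀ (by linarith)] at h₁
      linarith
    · have := mul_nonneg ht h
      linarith [hf i hi]
  · field_simp [hgj.ne]
    ring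

section

variable {R : Type*} [Field R] [LinearOrder R] {n : ℕ}

theorem exists_argmin_eq_of_mem_vertexSet {P : Set (Fin n → R)} {v : Fin n → R}
    (h : v ∈ vertexSet P) : ∃ c, argmin P c = {v} := by
  rcases h with h | ⟨c, hc⟩
  · exact absurd h (Set.singleton_ne_empty v)
  · exact ⟨c, hc.symm⟩

theorem mem_of_mem_vertexSet {P : Set (Fin n → R)} {v : Fin n → R} (h : v ∈ vertexSet P) :
    v ∈ P := by
  obtain ⟨c, hc⟩ := exists_argmin_eq_of_mem_vertexSet h
  have : v ∈ argmin P c := hc ▸ rfl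
  exact this.1

theorem lt_of_argmin_eq_singleton {P : Set (Fin n → R)} {c v y : Fin n → R}
    (hc : argmin P c = {v}) (hy : y ∈ P) (hne : y ≠ v) : c ⬝ᵥ v < c ⬝ᵥ y := by
  have hv : v ∈ argmin P c := hc ▸ rfl
  by_contra! hle
  have : y ∈ argmin P c := ⟨hy, fun z hz => hle.trans (hv.2 z hz)⟩
  rw [hc] at this
  exact hne this

end

section

variable {R : Type*} [Field R] [LinearOrder R] [IsStrictOrderedRing R] {m n : ℕ}

/-- The polyhedron defined by the system `A x ≥ b`. -/
def solutionSet (A : Fin m → Fin n → R) (b : Fin m → R) : Set (Fin n → R) :=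
  {x | ∀ i, b i ≤ A i ⬝ᵥ x}

/-- The only direction orthogonal to all the constraints active at `v` is zero. -/
def IsBasicPoint (A : Fin m → Fin n → R) (b : Fin m → R) (v : Fin n → R) : Prop :=
  ∀ d : Fin n → R, (∀ i, A i ⬝ᵥ v = b i → A i ⬝ᵥ d = 0) → d = 0

variable {A : Fin m → Fin n → R} {b : Fin m → R}

/-- The sum attains its lower bound `∑ b i` at `v`, and equality of the sums forces equality in each
term. This exhibits vertices and edges as faces. -/
theorem argmin_sum_constraints {v : Fin n → R} (hv : v ∈ solutionSet A b) (J : Finset (Fin m))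
    (hJ : ∀ i ∈ J, A i ⬝ᵥ v = b i) :
    argmin (solutionSet A b) (∑ i ∈ J, A i) =
      {y | y ∈ solutionSet A b ∧ ∀ i ∈ J, A i ⬝ᵥ y = b i} := by
  ext y
  simp only [argmin, Set.mem_ofPred_eq, sum_dotProduct]
  refine and_congr_right fun hy => ⟨fun h i hi => ?_, fun h z hz => ?_⟩
  · have h₁ : ∑ i ∈ J, A i ⬝ᵥ y ≤ ∑ i ∈ J, b i := (h v hv).trans_eq (Finset.sum_congr rfl hJ)
    have h₂ := (Finset.sum_eq_sum_iff_of_le fun i _ => hy i).1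
      (le_antisymm (Finset.sum_le_sum fun i _ => hy i) h₁)
    exact (h₂ i hi).symm
  · rw [Finset.sum_congr rfl h]
    exact Finset.sum_le_sum fun i _ => hz i

/-- In a bounded polyhedron, any nonzero feasible direction can be followed until a new constraint
becomes active. -/
theorem exists_blocking_step (hB : IsBoundedSet (solutionSet A b)) {v d : Fin n → R}
    (hv : v ∈ solutionSet A b) (hd : d ≠ 0) (hdir : ∀ i, A i ⬝ᵥ v = b i → 0 ≤ A i ⬝ᵥ d) :
    ∃ t : R, 0 < t ∧ v + t • d ∈ solutionSet A b ∧
      ∃ j, A j ⬝ᵥ d < 0 ∧ A j ⬝ᵥ (v + t • d) = b j := by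
  have hex : ∃ i ∈ (Finset.univ : Finset (Fin m)), A i ⬝ᵥ d < 0 := by
    by_contra! hcon
    obtain ⟨M, hM⟩ := hB
    obtain ⟨k, hk⟩ := Function.ne_iff.1 hd
    have hk' : 0 < |d k| := abs_pos.2 hk
    have hMv := hM v hv k
    have hM0 : 0 ≤ M + 1 + |v k| := by linarith [abs_nonneg (v k)]
    -- Large enough that coordinate `k` of `v + t • d` exceeds `M` in absolute value.
    set t := (M + 1 + |v k|) / |d k| with ht
    have ht0 : 0 ≤ t := div_nonneg hM0 hk'.le
    have hmem : v + t • d ∈ solutionSet A b := fun i => by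
      rw [dotProduct_add, dotProduct_smul, smul_eq_mul]
      have := mul_nonneg ht0 (hcon i (Finset.mem_univ i))
      linarith [hv i]
    have h₁ := hM _ hmem k
    have h₂ : |t * d k| = M + 1 + |v k| := by
      rw [abs_mul, abs_of_nonneg ht0, ht, div_mul_cancel₀ _ hk'.ne']
    have h₃ : |t * d k| ≤ |v k + t * d k| + |v k| := by
      simpa using abs_sub (v k + t * d k) (v k)
    simp only [Pi.add_apply, Pi.smul_apply, smul_eq_mul] at h₁
    linarith
  obtain ⟨t, ht, hall, j, -, hj, hj0⟩ := exists_ratio_test Finset.univ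
    (fun i => A i ⬝ᵥ v - b i) (fun i => A i ⬝ᵥ d) (fun i _ => sub_nonneg.2 (hv i)) hex
  refine ⟨t, ht.lt_of_ne ?_, fun i => ?_, j, hj, ?_⟩
  · rintro rfl
    exact (hdir j (by linarith)).not_gt hj
  · rw [dotProduct_add, dotProduct_smul, smul_eq_mul]
    linarith [hall i (Finset.mem_univ i)]
  · rw [dotProduct_add, dotProduct_smul, smul_eq_mul]
    linarith

/-- If `d ≠ 0` were orthogonal to the active constraints, both `d` and `-d` would be feasible, so
both would strictly increase `c`. Conversely, the sum of the active constraints is minimized only at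
`v`. -/
theorem mem_vertexSet_iff (hB : IsBoundedSet (solutionSet A b)) {v : Fin n → R} :
    v ∈ vertexSet (solutionSet A b) ↔ v ∈ solutionSet A b ∧ IsBasicPoint A b v := by
  classical
  constructor
  · intro h
    have hv := mem_of_mem_vertexSet h
    obtain ⟨c, hc⟩ := exists_argmin_eq_of_mem_vertexSet h
    refine ⟨hv, fun d hd => ?_⟩
    by_contra hd0
    have key : ∀ e : Fin n → R, e ≠ 0 → (∀ i, A i ⬝ᵥ v = b i → 0 ≤ A i ⬝ᵥ e) → 0 < c ⬝ᵥ e := by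
      intro e he hdir
      obtain ⟨t, ht, hmem, -⟩ := exists_blocking_step hB hv he hdir
      have h₁ := lt_of_argmin_eq_singleton hc hmem (by simp [ht.ne', he])
      rw [dotProduct_add, dotProduct_smul, smul_eq_mul] at h₁
      exact pos_of_mul_pos_right (by linarith : 0 < t * (c ⬝ᵥ e)) ht.le
    have h₁ := key d hd0 fun i hi => (hd i hi).ge
    have h₂ := key (-d) (neg_ne_zero.2 hd0) fun i hi => by rw [dotProduct_neg, hd i hi, neg_zero]
    rw [dotProduct_neg] at h₂
    linarith
  · rintro ⟨hv, hbasic⟩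
    refine Or.inr ⟨∑ i ∈ Finset.univ.filter (fun i => A i ⬝ᵥ v = b i), A i, ?_⟩
    rw [argmin_sum_constraints hv _ fun i hi => (Finset.mem_filter.1 hi).2]
    ext y
    simp only [Set.mem_singleton_iff, Finset.mem_filter, Finset.mem_univ, true_and,
      Set.mem_ofPred_eq]
    constructor
    · rintro rfl
      exact ⟨hv, fun _ h => h⟩
    · rintro ⟨-, h⟩
      refine sub_eq_zero.1 (hbasic _ fun i hi => ?_)
      rw [dotProduct_sub, h i hi, hi, sub_self]

/-- A vertex is determined by its set of active constraints. -/
theorem finite_vertexSet (hB : IsBoundedSet (solutionSet A b)) :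
    (vertexSet (solutionSet A b)).Finite := by
  refine Set.Finite.of_finite_image (f := fun v => {i | A i ⬝ᵥ v = b i}) (Set.toFinite _) ?_
  intro v hv w _ h
  refine sub_eq_zero.1 (((mem_vertexSet_iff hB).1 hv).2 _ fun i hi => ?_)
  have hi' : A i ⬝ᵥ w = b i := h.subset hi
  rw [dotProduct_sub, hi, hi', sub_self]

/-- At a basic point, if some feasible direction decreases `c`, then so does the direction of an
extreme ray of the cone of feasible directions. -/
theorem exists_decreasing_extreme_direction {v c y : Fin n → R} (hbasic : IsBasicPoint A b v)
    (hy : ∀ i, A i ⬝ᵥ v = b i → 0 ≤ A i ⬝ᵥ y) (hcy : c ⬝ᵥ y < 0) :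
    ∃ d : Fin n → R, (∀ i, A i ⬝ᵥ v = b i → 0 ≤ A i ⬝ᵥ d) ∧ c ⬝ᵥ d < 0 ∧
      ∀ e : Fin n → R, (∀ i, A i ⬝ᵥ v = b i → A i ⬝ᵥ d = 0 → A i ⬝ᵥ e = 0) →
        ∃ μ : R, e = μ • d := by
  classical
  let D : Set (Fin n → R) := {d | (∀ i, A i ⬝ᵥ v = b i → 0 ≤ A i ⬝ᵥ d) ∧ c ⬝ᵥ d < 0}
  let J : (Fin n → R) → Set (Fin m) := fun d => {i | A i ⬝ᵥ v = b i ∧ A i ⬝ᵥ d = 0}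
  -- Extremality of the ray comes from making the set `J d` of constraints tight along `d` maximal.
  obtain ⟨_, ⟨⟨d, ⟨hd, hcd⟩, rfl⟩, hmax⟩⟩ :=
    (Set.toFinite (J '' D)).exists_maximal ⟨J y, y, ⟨hy, hcy⟩, rfl⟩
  -- Otherwise, moving `d` along `e` until blocked keeps `c` and `J d` and makes one more constraint
  -- tight.
  have hblock : ∀ e : Fin n → R, c ⬝ᵥ e = 0 → (∀ i ∈ J d, A i ⬝ᵥ e = 0) →
      ∀ i, A i ⬝ᵥ v = b i → 0 ≤ A i ⬝ᵥ e := by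
    intro e hce he
    by_contra! hneg
    obtain ⟨i₀, hi₀, hlt⟩ := hneg
    obtain ⟨t, -, hall, j, hj, hjneg, hj0⟩ := exists_ratio_test
      (Finset.univ.filter fun i => A i ⬝ᵥ v = b i) (fun i => A i ⬝ᵥ d) (fun i => A i ⬝ᵥ e)
      (fun i hi => hd i (Finset.mem_filter.1 hi).2)
      ⟨i₀, Finset.mem_filter.2 ⟨Finset.mem_univ _, hi₀⟩, hlt⟩
    have hdot : ∀ x : Fin n → R, x ⬝ᵥ (d + t • e) = x ⬝ᵥ d + t * (x ⬝ᵥ e) := fun x => by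
      rw [dotProduct_add, dotProduct_smul, smul_eq_mul]
    have hmem : d + t • e ∈ D := by
      refine ⟨fun i hi => ?_, ?_⟩
      · rw [hdot]
        exact hall i (Finset.mem_filter.2 ⟨Finset.mem_univ _, hi⟩)
      · rwa [hdot, hce, mul_zero, add_zero]
    have hle : J d ≤ J (d + t • e) := fun i hi => ⟨hi.1, by rw [hdot, hi.2, he i hi]; simp⟩
    have hjJ : j ∈ J d := hmax ⟨_, hmem, rfl⟩ hle
      ⟨(Finset.mem_filter.1 hj).2, by rw [hdot]; exact hj0⟩
    exact hjneg.ne (he j hjJ)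
  -- Once its `c`-component is removed, `hblock` applies to the remainder and its negative, so
  -- basicness makes it zero.
  refine ⟨d, hd, hcd, fun e he => ⟨(c ⬝ᵥ e) / (c ⬝ᵥ d), sub_eq_zero.1 ?_⟩⟩
  have hce : c ⬝ᵥ (e - ((c ⬝ᵥ e) / (c ⬝ᵥ d)) • d) = 0 := by
    rw [dotProduct_sub, dotProduct_smul, smul_eq_mul, div_mul_cancel₀ _ hcd.ne, sub_self]
  have hJe : ∀ i ∈ J d, A i ⬝ᵥ (e - ((c ⬝ᵥ e) / (c ⬝ᵥ d)) • d) = 0 := fun i hi => by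
    rw [dotProduct_sub, dotProduct_smul, he i hi.1 hi.2, hi.2, smul_zero, sub_zero]
  refine hbasic _ fun i hi => le_antisymm ?_ (hblock _ hce hJe i hi)
  have := hblock (-(e - ((c ⬝ᵥ e) / (c ⬝ᵥ d)) • d)) (by rw [dotProduct_neg, hce, neg_zero])
    (fun i hi => by rw [dotProduct_neg, hJe i hi, neg_zero]) i hi
  rw [dotProduct_neg] at this
  linarith

/-- A vertex of a polytope which does not minimize `c` has a neighbour with a smaller value. -/
theorem exists_adj_lt (hB : IsBoundedSet (solutionSet A b)) {v c y : Fin n → R}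
    (hv : v ∈ vertexSet (solutionSet A b)) (hy : y ∈ solutionSet A b) (hlt : c ⬝ᵥ y < c ⬝ᵥ v) :
    ∃ v' ∈ vertexSet (solutionSet A b), Adj (solutionSet A b) v v' ∧ c ⬝ᵥ v' < c ⬝ᵥ v := by
  classical
  obtain ⟨hvP, hbasic⟩ := (mem_vertexSet_iff hB).1 hv
  obtain ⟨d, hd, hcd, hker⟩ := exists_decreasing_extreme_direction (y := y - v) (c := c) hbasic
    (fun i hi => by rw [dotProduct_sub, hi]; exact sub_nonneg.2 (hy i))
    (by rw [dotProduct_sub]; linarith)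
  have hd0 : d ≠ 0 := by
    rintro rfl
    simp at hcd
  obtain ⟨t, ht, hmem, j, hj, hjb⟩ := exists_blocking_step hB hvP hd0 hd
  have hdot : ∀ (x : Fin n → R) (s : R), x ⬝ᵥ (v + s • d) = x ⬝ᵥ v + s * (x ⬝ᵥ d) := fun x s => by
    rw [dotProduct_add, dotProduct_smul, smul_eq_mul]
  -- On the line through `v` along `d`, constraint `k` cuts off parameters below `0` and `j` those
  -- above `t`.
  obtain ⟨k, hkv, hkd⟩ : ∃ k, A k ⬝ᵥ v = b k ∧ 0 < A k ⬝ᵥ d := by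
    by_contra! hcon
    exact hd0 (hbasic d fun i hi => le_antisymm (hcon i hi) (hd i hi))
  refine ⟨v + t • d, (mem_vertexSet_iff hB).2 ⟨hmem, fun e he => ?_⟩, ⟨?_, Or.inr
    ⟨∑ i ∈ Finset.univ.filter (fun i => A i ⬝ᵥ v = b i ∧ A i ⬝ᵥ d = 0), A i, ?_⟩⟩, ?_⟩
  · obtain ⟨μ, rfl⟩ := hker e fun i hi hid => he i (by rw [hdot, hid, hi, mul_zero, add_zero])
    have h₁ := he j hjb
    rw [dotProduct_smul, smul_eq_mul] at h₁
    rw [(mul_eq_zero.1 h₁).resolve_right hj.ne, zero_smul]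
  · simp [ht.ne', hd0]
  · rw [argmin_sum_constraints hvP _ fun i hi => (Finset.mem_filter.1 hi).2.1, segment_eq_image']
    ext z
    simp only [Set.mem_image, Set.mem_Icc, Set.mem_ofPred_eq, Finset.mem_filter, Finset.mem_univ,
      true_and, add_sub_cancel_left, smul_smul]
    constructor
    · rintro ⟨s, ⟨hs0, hs1⟩, rfl⟩
      refine ⟨fun i => ?_, fun i hi => by rw [hdot, hi.2, hi.1, mul_zero, add_zero]⟩
      have h₁ := mul_nonneg (sub_nonneg.2 hs1) (sub_nonneg.2 (hvP i))
      have h₂ := mul_nonneg hs0 (sub_nonneg.2 (hmem i))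
      rw [hdot] at h₂ ⊢
      linarith
    · rintro ⟨hz, hzJ⟩
      obtain ⟨μ, hμ⟩ := hker (z - v) fun i hi hid => by
        rw [dotProduct_sub, hzJ i ⟨hi, hid⟩, hi, sub_self]
      obtain rfl : z = v + μ • d := by rw [← hμ, add_sub_cancel]
      have hμ0 : 0 ≤ μ := by
        have h₁ := hz k
        rw [hdot, hkv] at h₁
        exact nonneg_of_mul_nonneg_left (by linarith : 0 ≤ μ * (A k ⬝ᵥ d)) hkd
      have hμt : μ ≤ t := by
        have h₁ := hz j
        rw [← hjb, hdot, hdot] at h₁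
        exact (mul_le_mul_right_of_neg hj).1 (by linarith)
      exact ⟨μ / t, ⟨div_nonneg hμ0 ht.le, (div_le_one ht).2 hμt⟩,
        by rw [div_mul_cancel₀ _ ht.ne']⟩
  · rw [hdot]
    have := mul_neg_of_pos_of_neg ht hcd
    linarith

end

end Polyhedra

theorem mainTheorem9 {R : Type*} [Field R] [LinearOrder R] [IsStrictOrderedRing R] {n : ℕ}
    (P : Set (Fin n → R)) (hP : Polyhedra.IsPolytope P) (v w : Fin n → R)
    (hv : v ∈ Polyhedra.vertexSet P) (hw : w ∈ Polyhedra.vertexSet P) :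
    ∃ p : List (Fin n → R),
      List.IsChain (Polyhedra.Adj P) (v :: p) ∧
      (∀ u ∈ v :: p, u ∈ Polyhedra.vertexSet P) ∧
      (v :: p).getLast (List.cons_ne_nil v p) = w := by
  obtain ⟨⟨m, A, b, hPeq⟩, hB⟩ := hP
  obtain rfl : P = Polyhedra.solutionSet A.row b := hPeq
  obtain ⟨c, hc⟩ := Polyhedra.exists_argmin_eq_of_mem_vertexSet hw
  by_contra hcon
  -- Among the vertices not connected to `w`, take one minimizing `c`; it has a lower neighbour.
  obtain ⟨u, ⟨hu, hbad⟩, hmin⟩ := Set.exists_min_image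
    {u | u ∈ Polyhedra.vertexSet (Polyhedra.solutionSet A.row b) ∧ ¬ ∃ p : List (Fin n → R),
      List.IsChain (Polyhedra.Adj (Polyhedra.solutionSet A.row b)) (u :: p) ∧
      (∀ x ∈ u :: p, x ∈ Polyhedra.vertexSet (Polyhedra.solutionSet A.row b)) ∧
      (u :: p).getLast (List.cons_ne_nil u p) = w}
    (fun u => c ⬝ᵥ u) ((Polyhedra.finite_vertexSet hB).subset fun _ h => h.1) ⟨v, hv, hcon⟩
  have huw : u ≠ w := by
    rintro rfl
    exact hbad ⟨[], by simp, by simpa using hu, by simp⟩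
  obtain ⟨u', hu', hadj, hlt⟩ := Polyhedra.exists_adj_lt hB hu (Polyhedra.mem_of_mem_vertexSet hw)
    (Polyhedra.lt_of_argmin_eq_singleton hc (Polyhedra.mem_of_mem_vertexSet hu) huw)
  by_cases h : ∃ p : List (Fin n → R),
      List.IsChain (Polyhedra.Adj (Polyhedra.solutionSet A.row b)) (u' :: p) ∧
      (∀ x ∈ u' :: p, x ∈ Polyhedra.vertexSet (Polyhedra.solutionSet A.row b)) ∧
      (u' :: p).getLast (List.cons_ne_nil u' p) = w
  · obtain ⟨p, hchain, hvert, hlast⟩ := h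
    refine hbad ⟨u' :: p, List.isChain_cons_cons.2 ⟨hadj, hchain⟩,
      List.forall_mem_cons.2 ⟨hu, hvert⟩, ?_⟩
    rwa [List.getLast_cons (List.cons_ne_nil u' p)]
  · exact (hmin u' ⟨hu', h⟩).not_gt hlt
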